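/- Let $(p_j)_{j\ge 1}$ be a probability mass function on a countable set of symbols. Let $U_1,U_2,\dots$ be i.i.d. with distribution $(p_j)$ and, for each $t\ge 0$, let $N(t)$ be a Poisson random variable with expectation $t$, independent of $(U_i)_{i\ge1}$ (the Poisson setting). Put \[ X_j(t)=\sum_{i=1}^{N(t)}\mathbf 1_{\{U_i=j\}},\qquad K_r(t)=\bigl|\{j: X_j(t)=r\}\bigr|\ (r\ge 1),\qquad M_0(t)=\sum_{j\ge 1}p_j\mathbf 1_{\{X_j(t)=0\}},\qquad G_0(t)=\frac{K_1(t)}{t}, \] so that $M_0(t)$ is the missing mass and $G_0(t)$ its Good--Turing estimator. Let $\vec\nu(x)=|\{j: p_j\ge x\}|$ for $x>0$, and assume that $\vec\nu$ is regularly varying with index $\alpha\in(0,1]$, that is, $\vec\nu(1/x)\sim x^{\alpha}\ell(x)$ as $x\to\infty$ for some slowly varying function $\ell$ (meaning $\lim_{\tau\to\infty}\ell(\tau x)/\ell(\tau)=1$ for all $x>0$). Then, as $t\to\infty$, \[ \frac{\mathbb E K_1(t)}{\sqrt{\mathbb E K_1(t)+2\,\mathbb E K_2(t)}}\left(\frac{G_0(t)}{M_0(t)}-1\right)\rightsquigarrow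 \mathcal N(0,1), \] where $\rightsquigarrow$ denotes convergence in distribution. -/

import Mathlib

open Filter Topology MeasureTheory ProbabilityTheory Asymptotics
open scoped NNReal ENNReal

namespace UrnScheme

/-- The counting function of a probability mass function `p` on the countable set of symbols:
`ν(x)` is the number of symbols `j` with `p j ≥ x` (a finite number for `x > 0`). -/
noncomputable def countingFunction (p : PMF ℕ) (x : ℝ) : ℕ :=
  Set.ncard {j : ℕ | x ≤ (p j).toReal}

/-- `ℓ` is slowly varying at `+∞`. -/
def IsSlowlyVarying (l : ℝ → ℝ) : Prop :=
  ∀ x : ℝ, 0 < x → Tendsto (fun τ : ℝ => l (τ * x) / l τ) atTop (𝓝 1)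

/-- The counting function of `p` is regularly varying with index `α`: `ν(1/x) ∼ x ^ α * ℓ(x)` as
`x → ∞` for some slowly varying `ℓ`. -/
def IsRegularlyVarying (p : PMF ℕ) (α : ℝ) : Prop :=
  ∃ l : ℝ → ℝ, IsSlowlyVarying l ∧
    (fun x : ℝ => (countingFunction p (1 / x) : ℝ)) ~[atTop] (fun x : ℝ => x ^ α * l x)

section Scheme

variable {Ω : Type*}

/-- The Poisson setting for the sampling distribution `p`: the observations `U 0, U 1, …` are
i.i.d. with distribution `p`, and for every `t ≥ 0` the sample size `N t` is a Poisson random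
variable with expectation `t`, independent of the sequence of observations. -/
structure IsPoissonSetting [MeasurableSpace Ω] (P : Measure Ω) (p : PMF ℕ)
    (U : ℕ → Ω → ℕ) (N : ℝ≥0 → Ω → ℕ) : Prop where
  hasLaw_obs : ∀ i, HasLaw (U i) p.toMeasure P
  iIndepFun_obs : iIndepFun U P
  hasLaw_size : ∀ t, HasLaw (N t) (poissonMeasure t) P
  indepFun_size_obs : ∀ t, IndepFun (N t) (fun ω i => U i ω) P

/-- `X_j(t)`: the number of occurrences of the symbol `j` among the first `N t` observations. -/
def occurrences (U : ℕ → Ω → ℕ) (N : ℝ≥0 → Ω → ℕ) (t : ℝ≥0) (j : ℕ) (ω : Ω) : ℕ :=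
  ∑ i ∈ Finset.range (N t ω), if U i ω = j then 1 else 0

/-- The occupancy count `K_r(t)`, `r ≥ 1`: the number of symbols that appear exactly `r` times
in the sample (finite since `r ≥ 1`). -/
noncomputable def occupancyCount (U : ℕ → Ω → ℕ) (N : ℝ≥0 → Ω → ℕ) (r : ℕ) (t : ℝ≥0)
    (ω : Ω) : ℝ :=
  (Set.ncard {j : ℕ | occurrences U N t j ω = r} : ℝ)

/-- The mass `M_r(t)` of the symbols that appear exactly `r` times in the sample; `M_0(t)` is the
missing mass. -/
noncomputable def rareMass (p : PMF ℕ) (U : ℕ → Ω → ℕ) (N : ℝ≥0 → Ω → ℕ) (r : ℕ) (t : ℝ≥0)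
    (ω : Ω) : ℝ :=
  ∑' j : ℕ, if occurrences U N t j ω = r then (p j).toReal else 0

/-- The Good–Turing estimator `G_r(t) = (r + 1) K_{r+1}(t) / t` of `M_r(t)`. -/
noncomputable def goodTuring (U : ℕ → Ω → ℕ) (N : ℝ≥0 → Ω → ℕ) (r : ℕ) (t : ℝ≥0)
    (ω : Ω) : ℝ :=
  ((r : ℝ) + 1) * occupancyCount U N (r + 1) t ω / (t : ℝ)

/-- The expected occupancy count `E K_r(t)`. -/
noncomputable def expectedCount [MeasurableSpace Ω] (P : Measure Ω)
    (U : ℕ → Ω → ℕ) (N : ℝ≥0 → Ω → ℕ) (r : ℕ) (t : ℝ≥0) : ℝ :=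
  ∫ ω, occupancyCount U N r t ω ∂P

end Scheme

end UrnScheme

/-! Write `x_j = t p_j`. With a Poisson sample size the counts `X_j(t)` are independent Poisson
variables of rates `x_j`, and `K_1 - t M_0 = ∑_j (1{X_j = 1} - x_j 1{X_j = 0})`. Each term is
centred, because `P(X_j = 1) = x_j e^{-x_j} = x_j P(X_j = 0)`, and its variance is `(x_j + x_j²)
e^{-x_j}`. The total variance is therefore `V = E K_1 + 2 E K_2`, and the statistic factors as `(K_1
- t M_0)/√V` times `E K_1/(t M_0)`. The first factor is asymptotically normal
(`tendstoInDistribution_normalized`), the second tends to 1 in probability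
(`tendstoInMeasure_missingMass`), and Slutsky's lemma concludes.

Both limits need `E K_1 → ∞` and error sums of order `E K_1`: third moments `∑ (x_j + x_j³)
e^{-x_j}` for the first, `∑ x_j² e^{-x_j}` for the second. Symbols with `x_j ≤ 1` are dominated by
their own share of `E K_1`; the others contribute at most a constant each, hence `O(ν(1/t))`.
Regular variation enters through `ν(1/(2t))/ν(1/t) → 2^α > 1`: a positive proportion of `ν(1/t)`
symbols has `x_j` in `[1/2, 1)`, and each adds a fixed amount to `E K_1`. Hence `ν(1/t) = O(E K_1)`
(`exists_countingFunction_le`). -/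

namespace UrnScheme

/-! ### Poissonization -/

section Poissonization

variable {Ω : Type*} [MeasurableSpace Ω] {P : Measure Ω} {p : PMF ℕ}
  {U : ℕ → Ω → ℕ} {N : ℝ≥0 → Ω → ℕ}

lemma IsPoissonSetting.aemeasurable_obs (hS : IsPoissonSetting P p U N) (i : ℕ) :
    AEMeasurable (U i) P := (hS.hasLaw_obs i).aemeasurable

lemma IsPoissonSetting.aemeasurable_size (hS : IsPoissonSetting P p U N) (t : ℝ≥0) :
    AEMeasurable (N t) P := (hS.hasLaw_size t).aemeasurable

lemma IsPoissonSetting.aemeasurable_comp_size_obs (hS : IsPoissonSetting P p U N) (t : ℝ≥0)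
    {β : Type*} [MeasurableSpace β] {F : ℕ → (ℕ → ℕ) → β} (hF : ∀ n, Measurable (F n)) :
    AEMeasurable (fun ω => F (N t ω) (fun i => U i ω)) P := by
  have h : Measurable (fun z : ℕ × (ℕ → ℕ) => F z.1 z.2) :=
    measurable_from_prod_countable_right hF
  exact h.comp_aemeasurable
    ((hS.aemeasurable_size t).prodMk (aemeasurable_pi_lambda _ hS.aemeasurable_obs))

lemma IsPoissonSetting.aemeasurable_occurrences (hS : IsPoissonSetting P p U N) (t : ℝ≥0)
    (j : ℕ) : AEMeasurable (occurrences U N t j) P := by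
  refine hS.aemeasurable_comp_size_obs t
    (F := fun n u => ∑ i ∈ Finset.range n, if u i = j then 1 else 0) fun n => ?_
  refine Finset.measurable_fun_sum _ fun i _ => ?_
  exact (Measurable.of_discrete (f := fun k : ℕ => if k = j then 1 else 0)).comp
    (measurable_pi_apply i)

variable [IsProbabilityMeasure P]

/-- The probability generating functional of the Poissonized sample. -/
lemma IsPoissonSetting.integral_prod_range_size (hS : IsPoissonSetting P p U N) (t : ℝ≥0)
    (f : ℕ → ℂ) (hf : ∀ k, ‖f k‖ ≤ 1) :
    ∫ ω, ∏ i ∈ Finset.range (N t ω), f (U i ω) ∂P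
      = Complex.exp (t * ((∫ k, f k ∂p.toMeasure) - 1)) := by
  set m := ∫ k, f k ∂p.toMeasure with hm
  have hUm : AEMeasurable (fun ω i => U i ω) P := aemeasurable_pi_lambda _ hS.aemeasurable_obs
  have hFn : ∀ n, Measurable (fun u : ℕ → ℕ => ∏ i ∈ Finset.range n, f (u i)) := fun n => by
    have hi : ∀ i, Measurable (fun u : ℕ → ℕ => f (u i)) := fun i =>
      (Measurable.of_discrete (f := f)).comp (measurable_pi_apply i)
    exact Finset.measurable_fun_prod _ fun i _ => hi i
  have hF : Measurable (fun z : ℕ × (ℕ → ℕ) => ∏ i ∈ Finset.range z.1, f (z.2 i)) :=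
    measurable_from_prod_countable_right hFn
  have hn : ∀ n, ∫ u, ∏ i ∈ Finset.range n, f (u i) ∂(P.map (fun ω i => U i ω)) = m ^ n := by
    intro n
    rw [integral_map hUm (hFn n).aestronglyMeasurable]
    have h1 : iIndepFun (fun i : Fin n => U i) P :=
      hS.iIndepFun_obs.precomp Fin.val_injective
    have h2 := h1.integral_fun_prod_comp (f := fun _ => f)
      (fun i => hS.aemeasurable_obs i) (fun i => by
        exact (Measurable.of_discrete (f := f)).aestronglyMeasurable)
    simp_rw [Finset.prod_range]
    rw [h2]
    have h3 : ∀ i : ℕ, ∫ ω, f (U i ω) ∂P = m := fun i =>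
      (hS.hasLaw_obs i).integral_comp (f := f)
        (Measurable.of_discrete (f := f)).aestronglyMeasurable
    simp [h3]
  have hb : ∀ z : ℕ × (ℕ → ℕ), ‖∏ i ∈ Finset.range z.1, f (z.2 i)‖ ≤ 1 := fun z => by
    rw [norm_prod]
    exact Finset.prod_le_one (fun _ _ => norm_nonneg _) fun _ _ => hf _
  have := (indepFun_iff_map_prod_eq_prod_map_map (hS.aemeasurable_size t) hUm).1
    (hS.indepFun_size_obs t)
  have hP : IsProbabilityMeasure (P.map (fun ω i => U i ω)) :=
    Measure.isProbabilityMeasure_map hUm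
  calc ∫ ω, ∏ i ∈ Finset.range (N t ω), f (U i ω) ∂P
      = ∫ z, ∏ i ∈ Finset.range z.1, f (z.2 i)
          ∂(P.map (fun ω => (N t ω, fun i => U i ω))) := by
        rw [integral_map ((hS.aemeasurable_size t).prodMk hUm) hF.aestronglyMeasurable]
    -- Independence of size and observations makes the joint law a product, so Fubini integrates the
    -- observations out at fixed size.
    _ = ∫ n, m ^ n ∂(poissonMeasure t) := by
        rw [this, (hS.hasLaw_size t).map_eq, integral_prod]
        · simp_rw [hn]
        · exact Integrable.of_bound hF.aestronglyMeasurable 1 (ae_of_all _ hb)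
    _ = Complex.exp (t * (m - 1)) := by
        rw [integral_poissonMeasure]
        have h4 : ∀ n : ℕ, (Real.exp (-t) * (t : ℝ) ^ n / (n.factorial : ℝ)) • m ^ n
            = Complex.exp (-t) * ((t * m) ^ n / (n.factorial : ℂ)) := fun n => by
          rw [Complex.real_smul]; push_cast; ring
        simp_rw [h4]
        rw [tsum_mul_left, (NormedSpace.expSeries_div_hasSum_exp ((t : ℂ) * m)).tsum_eq,
          ← Complex.exp_eq_exp_ℂ, ← Complex.exp_add]
        ring_nf

/-- The generating functional is the exponential of a quantity linear in the test function, so it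
splits into one factor per symbol. This yields both the Poisson laws and the independence of the
counts. -/
lemma IsPoissonSetting.integral_exp_sum_occurrences (hS : IsPoissonSetting P p U N) (t : ℝ≥0)
    (F : Finset ℕ) (s : ℕ → ℝ) :
    ∫ ω, Complex.exp ((∑ j ∈ F, s j * occurrences U N t j ω : ℝ) * Complex.I) ∂P
      = ∏ j ∈ F, Complex.exp ((t * (p j).toReal : ℝ) * (Complex.exp (s j * Complex.I) - 1)) := by
  have key := hS.integral_prod_range_size t
    (fun k => if k ∈ F then Complex.exp (s k * Complex.I) else 1) (fun k => by
      split_ifs <;> simp [Complex.norm_exp_ofReal_mul_I])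
  have e1 : ∀ ω, Complex.exp ((∑ j ∈ F, s j * occurrences U N t j ω : ℝ) * Complex.I)
      = ∏ i ∈ Finset.range (N t ω),
        if U i ω ∈ F then Complex.exp (s (U i ω) * Complex.I) else 1 := fun ω => by
    have : (∑ j ∈ F, s j * occurrences U N t j ω : ℝ)
        = ∑ i ∈ Finset.range (N t ω), if U i ω ∈ F then s (U i ω) else 0 := by
      simp only [occurrences, Nat.cast_sum, Finset.mul_sum]
      rw [Finset.sum_comm]
      refine Finset.sum_congr rfl fun i _ => ?_
      simp
    rw [this]
    push_cast
    rw [Finset.sum_mul, Complex.exp_sum]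
    refine Finset.prod_congr rfl fun i _ => ?_
    split_ifs <;> simp
  have e2 : (∫ k, (if k ∈ F then Complex.exp (s k * Complex.I) else 1) ∂p.toMeasure) - 1
      = ∑ j ∈ F, ((p j).toReal : ℂ) * (Complex.exp (s j * Complex.I) - 1) := by
    have hi : Integrable (fun k => if k ∈ F then Complex.exp (s k * Complex.I) else 1)
        p.toMeasure := by
      refine Integrable.of_bound Measurable.of_discrete.aestronglyMeasurable 1 (ae_of_all _ ?_)
      intro k
      split_ifs <;> simp [Complex.norm_exp_ofReal_mul_I]
    have h1 : ∫ k, ((if k ∈ F then Complex.exp (s k * Complex.I) else 1) - 1) ∂p.toMeasure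
        = (∫ k, (if k ∈ F then Complex.exp (s k * Complex.I) else 1) ∂p.toMeasure) - 1 := by
      rw [integral_sub hi (integrable_const _)]
      simp
    rw [← h1, PMF.integral_eq_tsum]
    · rw [tsum_eq_sum (s := F)]
      · refine Finset.sum_congr rfl fun j hj => ?_
        simp [hj]
      · intro j hj
        simp [hj]
    · exact hi.sub (integrable_const _)
  simp_rw [e1]
  rw [key, e2, Finset.mul_sum, Complex.exp_sum]
  refine Finset.prod_congr rfl fun j _ => ?_
  push_cast
  ring_nf

/-- The Poisson rate of the symbol `j` at time `t`. -/
noncomputable def rate (p : PMF ℕ) (t : ℝ≥0) (j : ℕ) : ℝ≥0 := t * (p j).toNNReal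

lemma coe_rate (p : PMF ℕ) (t : ℝ≥0) (j : ℕ) : (rate p t j : ℝ) = t * (p j).toReal := rfl

lemma IsPoissonSetting.charFun_occurrences (hS : IsPoissonSetting P p U N) (t : ℝ≥0) (j : ℕ)
    (s : ℝ) : charFun (P.map (fun ω => (occurrences U N t j ω : ℝ))) s
      = Complex.exp (rate p t j * (Complex.exp (s * Complex.I) - 1)) := by
  have hm : AEMeasurable (fun ω => (occurrences U N t j ω : ℝ)) P :=
    (Measurable.of_discrete (f := ((↑) : ℕ → ℝ))).comp_aemeasurable
      (hS.aemeasurable_occurrences t j)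
  have := hS.integral_exp_sum_occurrences t {j} (fun _ => s)
  rw [charFun_apply_real, integral_map hm (by fun_prop)]
  simp only [Finset.sum_singleton, Finset.prod_singleton] at this
  rw [← coe_rate] at this
  push_cast at this
  exact this

/-- Poissonization: `X_j(t)` is a Poisson variable with rate `t * p j`. -/
lemma IsPoissonSetting.hasLaw_occurrences (hS : IsPoissonSetting P p U N) (t : ℝ≥0) (j : ℕ) :
    HasLaw (occurrences U N t j) (poissonMeasure (rate p t j)) P := by
  refine ⟨hS.aemeasurable_occurrences t j, ?_⟩
  apply (MeasurableEmbedding.natCast (α := ℝ)).map_injective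
  have hm := hS.aemeasurable_occurrences t j
  apply Measure.ext_of_charFun
  ext s
  rw [charFun_map_cast_poissonMeasure, AEMeasurable.map_map_of_aemeasurable (by fun_prop) hm]
  exact hS.charFun_occurrences t j s

/-- Poissonization: the numbers of occurrences of the symbols are independent. -/
lemma IsPoissonSetting.iIndepFun_occurrences (hS : IsPoissonSetting P p U N) (t : ℝ≥0) :
    iIndepFun (fun j => occurrences U N t j) P := by
  have hm : ∀ j, AEMeasurable (fun ω => (occurrences U N t j ω : ℝ)) P := fun j =>
    (Measurable.of_discrete (f := ((↑) : ℕ → ℝ))).comp_aemeasurable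
      (hS.aemeasurable_occurrences t j)
  have h : iIndepFun (fun j ω => (occurrences U N t j ω : ℝ)) P := by
    rw [iIndepFun_iff_finset]
    intro F
    have hX : ∀ j : F, AEMeasurable (F.restrict (fun j ω => (occurrences U N t j ω : ℝ)) j) P :=
      fun j => hm j
    rw [iIndepFun_iff_charFun_pi hX]
    intro s
    have hc : ∀ j : F, charFun (P.map (F.restrict (fun j ω => (occurrences U N t j ω : ℝ)) j))
        (s j) = Complex.exp (rate p t j * (Complex.exp (s j * Complex.I) - 1)) := fun j =>
      hS.charFun_occurrences t j (s j)
    simp_rw [hc]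
    have := hS.integral_exp_sum_occurrences t F
      (fun j => if h : j ∈ F then s ⟨j, h⟩ else 0)
    rw [← Finset.prod_coe_sort] at this
    rw [charFun_apply, integral_map]
    · simp only [Finset.coe_mem, dite_true, Subtype.coe_eta, ← coe_rate] at this
      rw [← this]
      congr 1
      ext ω
      rw [← Finset.sum_coe_sort]
      simp [PiLp.inner_apply, Finset.restrict, mul_comm]
    · exact (PiLp.continuous_toLp 2 _).measurable.comp_aemeasurable (aemeasurable_pi_lambda _ hX)
    · fun_prop
  have h2 := h.comp (fun _ x => ⌊x⌋₊) (fun _ => Nat.measurable_floor)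
  simpa [Function.comp_def] using h2

end Poissonization

end UrnScheme

namespace UrnScheme

/-! ### Estimates for characteristic functions -/

section CharFunEstimates

/-- The constant 4 is not sharp: it covers the Taylor remainder for `|u| ≤ 1` and the crude bound `1
+ 1 + |u| + u²/2` for `|u| ≥ 1`. -/
lemma norm_exp_mul_I_sub_taylor_le (u : ℝ) :
    ‖Complex.exp (u * Complex.I) - (1 + u * Complex.I - (u : ℂ) ^ 2 / 2)‖ ≤ 4 * |u| ^ 3 := by
  have hn : ‖(u : ℂ) * Complex.I‖ = |u| := by simp
  rcases le_total |u| 1 with h | h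
  · have := Complex.exp_bound (x := u * Complex.I) (by rw [hn]; exact h) (n := 3) (by norm_num)
    rw [hn] at this
    have e : ∑ m ∈ Finset.range 3, ((u : ℂ) * Complex.I) ^ m / (m.factorial : ℂ)
        = 1 + u * Complex.I - (u : ℂ) ^ 2 / 2 := by
      simp [Finset.sum_range_succ, mul_pow, Nat.factorial]
      ring
    rw [e] at this
    refine this.trans ?_
    have h3 : 0 ≤ |u| ^ 3 := by positivity
    norm_num [Nat.factorial]
    nlinarith
  · have h1 : ‖Complex.exp (u * Complex.I)‖ = 1 := Complex.norm_exp_ofReal_mul_I u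
    have h2 : ‖(1 : ℂ) + u * Complex.I - (u : ℂ) ^ 2 / 2‖ ≤ 1 + |u| + |u| ^ 2 / 2 := by
      refine (norm_sub_le _ _).trans (add_le_add ((norm_add_le _ _).trans ?_) ?_)
      · rw [hn]; simp
      · simp
    have h3 := norm_sub_le (Complex.exp (u * Complex.I)) (1 + u * Complex.I - (u : ℂ) ^ 2 / 2)
    have h4 : |u| ≤ |u| ^ 3 := le_self_pow₀ h (by norm_num)
    have h5 : |u| ^ 2 ≤ |u| ^ 3 := pow_le_pow_right₀ h (by norm_num)
    linarith

lemma abs_exp_neg_sub_one_add_le {y : ℝ} (hy : 0 ≤ y) : |Real.exp (-y) - (1 - y)| ≤ y ^ 2 := by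
  have h0 : 1 - y ≤ Real.exp (-y) := by linarith [Real.add_one_le_exp (-y)]
  rw [abs_of_nonneg (by linarith)]
  have h2 : Real.exp (-y) * (1 + y) ≤ 1 := by
    have := mul_le_mul_of_nonneg_left (Real.add_one_le_exp y) (Real.exp_pos (-y)).le
    rw [← Real.exp_add] at this
    simp at this
    linarith
  -- By `h2` the product is at most `1 - (1 - y²) - y² - y³ = -y³`.
  have h3 : (1 + y) * (Real.exp (-y) - (1 - y) - y ^ 2) ≤ 0 := by
    nlinarith [pow_nonneg hy 3]
  nlinarith [pow_nonneg hy 3]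

/-- Factors are exchanged one at a time, the remaining ones staying in the unit disc. -/
lemma norm_prod_range_sub_prod_range_le (a b : ℕ → ℂ) (ha : ∀ j, ‖a j‖ ≤ 1) (hb : ∀ j, ‖b j‖ ≤ 1)
    (n : ℕ) : ‖∏ j ∈ Finset.range n, a j - ∏ j ∈ Finset.range n, b j‖
      ≤ ∑ j ∈ Finset.range n, ‖a j - b j‖ := by
  induction n with
  | zero => simp
  | succ n ih =>
    rw [Finset.prod_range_succ, Finset.prod_range_succ, Finset.sum_range_succ]
    have e : (∏ j ∈ Finset.range n, a j) * a n - (∏ j ∈ Finset.range n, b j) * b n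
        = (∏ j ∈ Finset.range n, a j - ∏ j ∈ Finset.range n, b j) * a n
          + (∏ j ∈ Finset.range n, b j) * (a n - b n) := by ring
    rw [e]
    refine (norm_add_le _ _).trans (add_le_add ?_ ?_)
    · rw [norm_mul]
      exact (mul_le_of_le_one_right (norm_nonneg _) (ha n)).trans ih
    · rw [norm_mul]
      refine mul_le_of_le_one_left (norm_nonneg _) ?_
      rw [norm_prod]
      exact Finset.prod_le_one (fun _ _ => norm_nonneg _) fun j _ => hb j

/-- The contribution `1{n = 1} - x 1{n = 0}` of a symbol with Poisson rate `x` and `n` occurrences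
to the (rescaled) error of the Good–Turing estimator. -/
def deviation (x : ℝ) (n : ℕ) : ℝ := (if n = 1 then 1 else 0) - x * (if n = 0 then 1 else 0)

lemma integral_exp_deviation (x : ℝ≥0) (s : ℝ) :
    ∫ n, Complex.exp (s * deviation x n * Complex.I) ∂(poissonMeasure x)
      = 1 + Real.exp (-x) * (Complex.exp ((-(s * x) : ℝ) * Complex.I) - 1)
        + x * Real.exp (-x) * (Complex.exp (s * Complex.I) - 1) := by
  have hi : Integrable (fun n => Complex.exp (s * deviation x n * Complex.I))
      (poissonMeasure x) := by
    refine Integrable.of_bound Measurable.of_discrete.aestronglyMeasurable 1 (ae_of_all _ ?_)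
    intro k
    rw [← Complex.ofReal_mul, Complex.norm_exp_ofReal_mul_I]
  -- Subtracting 1 leaves only `n = 0` and `n = 1` in the Poisson series, since the deviation
  -- vanishes for `n ≥ 2`.
  have h1 : ∫ n, (Complex.exp (s * deviation x n * Complex.I) - 1) ∂(poissonMeasure x)
      = (∫ n, Complex.exp (s * deviation x n * Complex.I) ∂(poissonMeasure x)) - 1 := by
    rw [integral_sub hi (integrable_const _)]
    simp
  have h2 : ∫ n, (Complex.exp (s * deviation x n * Complex.I) - 1) ∂(poissonMeasure x)
      = Real.exp (-x) * (Complex.exp ((-(s * x) : ℝ) * Complex.I) - 1)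
        + x * Real.exp (-x) * (Complex.exp (s * Complex.I) - 1) := by
    rw [integral_poissonMeasure, tsum_eq_sum (s := Finset.range 2)]
    · simp [Finset.sum_range_succ, deviation, mul_comm (Complex.exp (-x)) (x : ℂ)]
    · intro n hn
      have hn0 : n ≠ 0 := fun h => hn (by simp [h])
      have hn1 : n ≠ 1 := fun h => hn (by simp [h])
      simp [deviation, hn0, hn1]
  rw [add_assoc, ← h2, h1]
  ring

lemma norm_charFun_deviation_sub_le {x : ℝ} (hx : 0 ≤ x) (s : ℝ) :
    ‖(1 + Real.exp (-x) * (Complex.exp ((-(s * x) : ℝ) * Complex.I) - 1)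
        + x * Real.exp (-x) * (Complex.exp (s * Complex.I) - 1) : ℂ)
      - Real.exp (-(s ^ 2 / 2 * ((x + x ^ 2) * Real.exp (-x))))‖
      ≤ 4 * |s| ^ 3 * ((x + x ^ 3) * Real.exp (-x))
        + s ^ 4 / 4 * ((x + x ^ 2) * Real.exp (-x)) ^ 2 := by
  set E := Real.exp (-x) with hE
  have hE0 : 0 < E := Real.exp_pos _
  set σ := (x + x ^ 2) * E with hσ
  have hσ0 : 0 ≤ σ := by positivity
  have h1 := norm_exp_mul_I_sub_taylor_le (-(s * x))
  have h2 := norm_exp_mul_I_sub_taylor_le s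
  have h3 := abs_exp_neg_sub_one_add_le (y := s ^ 2 / 2 * σ) (by positivity)
  set A := Complex.exp ((-(s * x) : ℝ) * Complex.I)
  set B := Complex.exp (s * Complex.I)
  set G := Real.exp (-(s ^ 2 / 2 * σ))
  -- The terms linear in `s` cancel (the deviation is centred) and the quadratic ones add up to
  -- `-s²σ/2`, so only remainders are left.
  have e : (1 + E * (A - 1) + x * E * (B - 1) : ℂ) - G
      = E * (A - (1 + (-(s * x) : ℝ) * Complex.I - ((-(s * x) : ℝ) : ℂ) ^ 2 / 2))
        + x * E * (B - (1 + s * Complex.I - (s : ℂ) ^ 2 / 2))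
        - ((G - (1 - s ^ 2 / 2 * σ) : ℝ) : ℂ) := by
    rw [hσ]; push_cast; ring
  rw [e]
  refine (norm_sub_le _ _).trans ?_
  have n1 : ‖(E : ℂ) * (A - (1 + (-(s * x) : ℝ) * Complex.I - ((-(s * x) : ℝ) : ℂ) ^ 2 / 2))‖
      ≤ E * (4 * |-(s * x)| ^ 3) := by
    rw [norm_mul, Complex.norm_real, Real.norm_of_nonneg hE0.le]
    gcongr
  have n2 : ‖(x : ℂ) * E * (B - (1 + s * Complex.I - (s : ℂ) ^ 2 / 2))‖
      ≤ x * E * (4 * |s| ^ 3) := by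
    rw [norm_mul, norm_mul, Complex.norm_real, Complex.norm_real, Real.norm_of_nonneg hE0.le,
      Real.norm_of_nonneg hx]
    gcongr
  have n3 : ‖((G - (1 - s ^ 2 / 2 * σ) : ℝ) : ℂ)‖ ≤ (s ^ 2 / 2 * σ) ^ 2 := by
    rw [Complex.norm_real]
    exact h3
  rw [abs_neg, abs_mul, abs_of_nonneg hx] at n1
  have := norm_add_le ((E : ℂ) * (A - (1 + (-(s * x) : ℝ) * Complex.I
    - ((-(s * x) : ℝ) : ℂ) ^ 2 / 2))) ((x : ℂ) * E * (B - (1 + s * Complex.I - (s : ℂ) ^ 2 / 2)))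
  calc _ ≤ E * (4 * (|s| * x) ^ 3) + x * E * (4 * |s| ^ 3) + (s ^ 2 / 2 * σ) ^ 2 := by linarith
    _ = _ := by ring

lemma self_mul_exp_neg_le {x : ℝ} : x * Real.exp (-x) ≤ 1 := by
  have h := Real.add_one_le_exp x
  rw [Real.exp_neg, ← div_eq_mul_inv, div_le_one (Real.exp_pos x)]
  linarith

lemma sq_mul_exp_neg_le {x : ℝ} (hx : 0 ≤ x) : x ^ 2 * Real.exp (-x) ≤ 2 := by
  have h := Real.quadratic_le_exp_of_nonneg hx
  rw [Real.exp_neg, ← div_eq_mul_inv, div_le_iff₀ (Real.exp_pos x)]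
  nlinarith

lemma cube_mul_exp_neg_le {x : ℝ} (hx : 0 ≤ x) : x ^ 3 * Real.exp (-x) ≤ 6 := by
  have h := Real.pow_div_factorial_le_exp x hx 3
  rw [Real.exp_neg, ← div_eq_mul_inv, div_le_iff₀ (Real.exp_pos x)]
  norm_num [Nat.factorial] at h
  linarith

end CharFunEstimates

end UrnScheme

namespace UrnScheme

/-! ### Regular variation of the counting function -/

section RegularVariation

variable {p : PMF ℕ}

lemma summable_toReal (p : PMF ℕ) : Summable fun j => (p j).toReal :=
  ENNReal.summable_toReal p.tsum_coe_ne_top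

lemma finite_setOf_le_toReal (p : PMF ℕ) {x : ℝ} (hx : 0 < x) :
    {j : ℕ | x ≤ (p j).toReal}.Finite := by
  have h := (summable_toReal p).tendsto_cofinite_zero.eventually (gt_mem_nhds hx)
  rw [Filter.eventually_cofinite] at h
  simpa using h

lemma monotone_countingFunction_one_div (p : PMF ℕ) :
    Monotone fun x : ℝ => countingFunction p (1 / x) := by
  intro x y hxy
  rcases le_or_gt x 0 with hx | hx
  -- For `x ≤ 0` the set is infinite and `ncard` takes the value 0, so monotonicity holds on all of
  -- `ℝ`.
  · have : {j : ℕ | 1 / x ≤ (p j).toReal} = Set.univ :=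
      Set.eq_univ_of_forall fun j => (one_div_nonpos.2 hx).trans ENNReal.toReal_nonneg
    simp only [countingFunction, this, Set.infinite_univ.ncard, Nat.zero_le]
  · refine Set.ncard_le_ncard (fun j hj => ?_)
      (finite_setOf_le_toReal p (one_div_pos.2 (hx.trans_le hxy)))
    exact (one_div_le_one_div_of_le hx hxy).trans hj

lemma IsRegularlyVarying.tendsto_doubling {α : ℝ} (h : IsRegularlyVarying p α) :
    Tendsto (fun x : ℝ => (countingFunction p (1 / (x * 2)) : ℝ) / countingFunction p (1 / x))
      atTop (𝓝 (2 ^ α)) := by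
  obtain ⟨l, hl, heq⟩ := h
  have hl2 := hl 2 two_pos
  -- If `l x = 0`, then `l (x * 2) / l x` is 0 by convention, which is excluded eventually by the
  -- limit 1.
  have hne : ∀ᶠ x : ℝ in atTop, x ^ α * l x ≠ 0 := by
    filter_upwards [hl2.eventually_ne one_ne_zero, eventually_gt_atTop 0] with x hx hx0
    refine mul_ne_zero (Real.rpow_pos_of_pos hx0 _).ne' fun h0 => hx ?_
    simp [h0]
  have h1 := (isEquivalent_iff_tendsto_one hne).1 heq
  have hdbl : Tendsto (fun x : ℝ => x * 2) atTop atTop := tendsto_id.atTop_mul_const two_pos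
  have h2 := h1.comp hdbl
  have h3 : Tendsto (fun x : ℝ => ((x * 2) ^ α * l (x * 2)) / (x ^ α * l x)) atTop (𝓝 (2 ^ α)) := by
    have := hl2.const_mul (2 ^ α : ℝ)
    rw [mul_one] at this
    refine this.congr' ?_
    filter_upwards [eventually_gt_atTop 0] with x hx
    rw [Real.mul_rpow hx.le two_pos.le]
    have := (Real.rpow_pos_of_pos hx α).ne'
    field_simp
  have h4 := (h2.mul h3).mul (h1.inv₀ one_ne_zero)
  simp only [one_mul, inv_one, mul_one] at h4
  refine h4.congr' ?_
  filter_upwards [hne, hdbl.eventually hne] with x hx hx2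
  simp only [Function.comp_apply, Pi.div_apply]
  generalize x ^ α * l x = u at hx
  generalize (x * 2) ^ α * l (x * 2) = v at hx2
  field_simp

lemma IsRegularlyVarying.exists_lt_doubling {α : ℝ} (hα : 0 < α) (h : IsRegularlyVarying p α) :
    ∃ c : ℝ, 0 < c ∧ ∀ᶠ x : ℝ in atTop, 0 < (countingFunction p (1 / x) : ℝ) ∧
      c * countingFunction p (1 / x)
        ≤ (countingFunction p (1 / (x * 2)) : ℝ) - countingFunction p (1 / x) := by
  have h1 : (1 : ℝ) < 2 ^ α := Real.one_lt_rpow one_lt_two hα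
  obtain ⟨d, hd1, hd2⟩ := exists_between h1
  refine ⟨d - 1, by linarith, ?_⟩
  filter_upwards [h.tendsto_doubling.eventually (lt_mem_nhds hd2)] with x hx
  have hpos : 0 < (countingFunction p (1 / x) : ℝ) := by
    rcases (Nat.cast_nonneg (α := ℝ) (countingFunction p (1 / x))).lt_or_eq with h0 | h0
    · exact h0
    · rw [← h0, div_zero] at hx
      linarith
  refine ⟨hpos, ?_⟩
  rw [lt_div_iff₀ hpos] at hx
  linarith

/-- A monotone function that does not diverge has a finite limit, so its increments over doublings
tend to 0; here they are eventually positive integers. -/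
lemma IsRegularlyVarying.tendsto_countingFunction {α : ℝ} (hα : 0 < α)
    (h : IsRegularlyVarying p α) :
    Tendsto (fun x : ℝ => (countingFunction p (1 / x) : ℝ)) atTop atTop := by
  have hmono : Monotone fun x : ℝ => (countingFunction p (1 / x) : ℝ) :=
    Nat.mono_cast.comp (monotone_countingFunction_one_div p)
  rcases tendsto_atTop_of_monotone hmono with h1 | ⟨L, hL⟩
  · exact h1
  · exfalso
    obtain ⟨c, hc, hev⟩ := h.exists_lt_doubling hα
    have hdbl : Tendsto (fun x : ℝ => x * 2) atTop atTop := tendsto_id.atTop_mul_const two_pos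
    have h2 := (hL.comp hdbl).sub hL
    rw [sub_self] at h2
    obtain ⟨x, ⟨hx1, hx2⟩, hx3⟩ :=
      (hev.and (h2.eventually (gt_mem_nhds (one_pos (α := ℝ))))).exists
    simp only [Function.comp_apply] at hx3
    have h3 : (countingFunction p (1 / x) : ℝ) < countingFunction p (1 / (x * 2)) := by
      nlinarith
    have h4 : (countingFunction p (1 / x) : ℝ) + 1 ≤ countingFunction p (1 / (x * 2)) := by
      exact_mod_cast h3
    linarith

lemma IsRegularlyVarying.infinite_support {α : ℝ} (hα : 0 < α) (h : IsRegularlyVarying p α) :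
    p.support.Infinite := by
  intro hfin
  obtain ⟨x, hx, hx0⟩ := ((h.tendsto_countingFunction hα).eventually_gt_atTop
    (p.support.ncard : ℝ)).and (eventually_gt_atTop 0) |>.exists
  have : countingFunction p (1 / x) ≤ p.support.ncard := by
    refine Set.ncard_le_ncard (fun j hj => ?_) hfin
    rw [PMF.mem_support_iff]
    intro h0
    have : 1 / x ≤ (p j).toReal := hj
    rw [h0, ENNReal.toReal_zero] at this
    exact (one_div_pos.2 hx0).not_ge this
  exact absurd hx (not_lt.2 (by exact_mod_cast this))

/-- `∑ j, t p_j exp (- t p_j)`, the expected number of symbols that occur once. -/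
noncomputable def meanOnes (p : PMF ℕ) (t : ℝ) : ℝ :=
  ∑' j, t * (p j).toReal * Real.exp (-(t * (p j).toReal))

lemma summable_meanOnes (p : PMF ℕ) {t : ℝ} (ht : 0 ≤ t) :
    Summable fun j => t * (p j).toReal * Real.exp (-(t * (p j).toReal)) := by
  refine Summable.of_nonneg_of_le (fun j => by positivity) (fun j => ?_)
    ((summable_toReal p).mul_left t)
  refine mul_le_of_le_one_right (by positivity) (Real.exp_le_one_iff.2 ?_)
  have : 0 ≤ t * (p j).toReal := by positivity
  linarith

/-- The left side counts the symbols with `1/2 ≤ t p_j < 1`, each of which contributes at least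
`e⁻¹/2` to `meanOnes`. -/
lemma countingFunction_sub_le_meanOnes (p : PMF ℕ) {t : ℝ} (ht : 0 < t) :
    (countingFunction p (1 / (t * 2)) : ℝ) - countingFunction p (1 / t)
      ≤ 2 * Real.exp 1 * meanOnes p t := by
  set A := (finite_setOf_le_toReal p (x := 1 / (t * 2)) (by positivity)).toFinset with hA
  set B := (finite_setOf_le_toReal p (x := 1 / t) (by positivity)).toFinset with hB
  have hBA : B ⊆ A := fun j hj => by
    simp only [hA, hB, Set.Finite.mem_toFinset, Set.mem_ofPred_eq] at hj ⊢
    exact (one_div_le_one_div_of_le ht (by linarith)).trans hj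
  have cA : countingFunction p (1 / (t * 2)) = A.card := Set.ncard_eq_toFinset_card _ _
  have cB : countingFunction p (1 / t) = B.card := Set.ncard_eq_toFinset_card _ _
  have hle : ∑ j ∈ A \ B, (1 / (2 * Real.exp 1))
      ≤ ∑ j ∈ A \ B, t * (p j).toReal * Real.exp (-(t * (p j).toReal)) := by
    refine Finset.sum_le_sum fun j hj => ?_
    simp only [hA, hB, Finset.mem_sdiff, Set.Finite.mem_toFinset, Set.mem_ofPred_eq, not_le] at hj
    have h1 : 1 / 2 ≤ t * (p j).toReal := by
      have := mul_le_mul_of_nonneg_left hj.1 ht.le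
      refine le_trans (le_of_eq ?_) this
      field_simp
    have h2 : t * (p j).toReal ≤ 1 := by
      have := mul_le_mul_of_nonneg_left hj.2.le ht.le
      refine this.trans (le_of_eq ?_)
      field_simp
    have h3 : Real.exp (-1) ≤ Real.exp (-(t * (p j).toReal)) := Real.exp_le_exp.2 (by linarith)
    calc 1 / (2 * Real.exp 1) = 1 / 2 * Real.exp (-1) := by rw [Real.exp_neg]; field_simp
      _ ≤ _ := by gcongr
  have htot : ∑ j ∈ A \ B, t * (p j).toReal * Real.exp (-(t * (p j).toReal)) ≤ meanOnes p t :=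
    (summable_meanOnes p ht.le).sum_le_tsum _ fun j _ => by positivity
  have h := hle.trans htot
  rw [Finset.sum_const, nsmul_eq_mul, Finset.cast_card_sdiff hBA] at h
  rw [cA, cB]
  have he := Real.exp_pos 1
  have := mul_le_mul_of_nonneg_left h (by positivity : 0 ≤ 2 * Real.exp 1)
  refine le_trans (le_of_eq ?_) this
  field_simp

/-- The dyadic block just below `1/t` holds at least `c ν(1/t)` symbols, so frequent symbols are
controlled by `meanOnes`. -/
lemma IsRegularlyVarying.exists_countingFunction_le {α : ℝ} (hα : 0 < α)
    (h : IsRegularlyVarying p α) :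
    ∃ C : ℝ, 0 < C ∧ ∀ᶠ t : ℝ in atTop, (countingFunction p (1 / t) : ℝ) ≤ C * meanOnes p t := by
  obtain ⟨c, hc, hev⟩ := h.exists_lt_doubling hα
  refine ⟨2 * Real.exp 1 / c, by positivity, ?_⟩
  filter_upwards [hev, eventually_gt_atTop 0] with t ht ht0
  have := ht.2.trans (countingFunction_sub_le_meanOnes p ht0)
  rw [div_mul_eq_mul_div, le_div_iff₀ hc]
  linarith

lemma IsRegularlyVarying.tendsto_meanOnes {α : ℝ} (hα : 0 < α) (h : IsRegularlyVarying p α) :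
    Tendsto (meanOnes p) atTop atTop := by
  obtain ⟨C, hC, hev⟩ := h.exists_countingFunction_le hα
  refine tendsto_atTop_mono' _ ?_ ((h.tendsto_countingFunction hα).atTop_div_const hC)
  filter_upwards [hev] with t ht
  rw [div_le_iff₀ hC]
  linarith

/-- Sums of `f (t p_j)` for functions `f` of linear growth at the origin that are bounded on
`[1, ∞)` are controlled by the expected number of symbols that occur once. -/
lemma tsum_le_meanOnes_add_countingFunction (p : PMF ℕ) {t : ℝ} (ht : 0 < t) {f : ℝ → ℝ}
    {a b : ℝ} (ha : 0 ≤ a)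
    (h1 : ∀ x, 0 ≤ x → x ≤ 1 → f x ≤ a * (x * Real.exp (-x)))
    (h2 : ∀ x, 1 ≤ x → f x ≤ b) (hf : Summable fun j => f (t * (p j).toReal)) :
    ∑' j, f (t * (p j).toReal) ≤ a * meanOnes p t + b * countingFunction p (1 / t) := by
  set B := (finite_setOf_le_toReal p (x := 1 / t) (by positivity)).toFinset with hB
  have cB : countingFunction p (1 / t) = B.card := Set.ncard_eq_toFinset_card _ _
  have hs : HasSum (fun j => if j ∈ B then b else 0) (b * B.card) := by
    have : HasSum (fun j => if j ∈ B then b else 0) (∑ j ∈ B, if j ∈ B then b else 0) :=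
      hasSum_sum_of_ne_finset_zero fun j hj => by simp [hj]
    convert this using 1
    rw [Finset.sum_ite_mem, Finset.inter_self, Finset.sum_const, nsmul_eq_mul, mul_comm]
  have hm := (summable_meanOnes p ht.le).hasSum.mul_left a
  rw [cB]
  refine hasSum_le (fun j => ?_) hf.hasSum (hm.add hs)
  have hx : 0 ≤ t * (p j).toReal := by positivity
  have hmem : j ∈ B ↔ 1 ≤ t * (p j).toReal := by
    simp only [hB, Set.Finite.mem_toFinset, Set.mem_ofPred_eq]
    rw [div_le_iff₀ ht, mul_comm]
  by_cases hj : j ∈ B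
  · have := h2 _ (hmem.1 hj)
    have h0 : 0 ≤ a * (t * (p j).toReal * Real.exp (-(t * (p j).toReal))) := by positivity
    simp only [hj, if_true]
    linarith
  · have := h1 _ hx (not_le.1 fun h => hj (hmem.2 h)).le
    simp only [hj, if_false]
    linarith

end RegularVariation

end UrnScheme

namespace UrnScheme

/-! ### Sums of functions of independent Poisson variables -/

section PoissonSums

variable {Ω : Type*} [MeasurableSpace Ω] {P : Measure Ω} {X : ℕ → Ω → ℕ} {x : ℕ → ℝ≥0}

lemma integral_ite_eq_of_hasLaw_poisson {Y : Ω → ℕ} {y : ℝ≥0} (hY : HasLaw Y (poissonMeasure y) P)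
    (r : ℕ) (c : ℝ) :
    ∫ ω, (if Y ω = r then c else 0) ∂P
      = c * (Real.exp (-y) * (y : ℝ) ^ r / (r.factorial : ℝ)) := by
  have h := hY.integral_comp (f := fun n => if n = r then c else 0)
    Measurable.of_discrete.aestronglyMeasurable
  simp only [Function.comp_def] at h
  rw [h, integral_poissonMeasure, tsum_eq_single r]
  · simp [mul_comm]
  · intro n hn
    simp [hn]

lemma integrable_comp_of_hasLaw [IsFiniteMeasure P] {Y : Ω → ℕ} (hY : AEMeasurable Y P)
    (f : ℕ → ℝ) {C : ℝ} (hf : ∀ n, |f n| ≤ C) : Integrable (fun ω => f (Y ω)) P :=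
  Integrable.of_bound ((Measurable.of_discrete (f := f)).comp_aemeasurable hY).aestronglyMeasurable
    C (ae_of_all _ fun _ => hf _)

variable [IsProbabilityMeasure P]

/-- The variance of `deviation x n` for `n` Poisson distributed with rate `x`. -/
noncomputable def deviationVar (x : ℝ) : ℝ := (x + x ^ 2) * Real.exp (-x)

lemma deviationVar_nonneg {x : ℝ} (hx : 0 ≤ x) : 0 ≤ deviationVar x := by
  unfold deviationVar; positivity

lemma deviationVar_le {x : ℝ} (hx : 0 ≤ x) : deviationVar x ≤ 3 := by
  have h1 := self_mul_exp_neg_le (x := x)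
  have h2 := sq_mul_exp_neg_le hx
  rw [deviationVar, add_mul]
  linarith

lemma deviationVar_le_mul {x : ℝ} (hx : 0 ≤ x) : deviationVar x ≤ 2 * x := by
  have h1 := self_mul_exp_neg_le (x := x)
  have h2 : Real.exp (-x) ≤ 1 := Real.exp_le_one_iff.2 (by linarith)
  rw [deviationVar]
  nlinarith

/-- The absolute third moment of `deviation x n` for `n` Poisson distributed with rate `x`. -/
noncomputable def deviationCube (x : ℝ) : ℝ := (x + x ^ 3) * Real.exp (-x)

lemma deviationCube_nonneg {x : ℝ} (hx : 0 ≤ x) : 0 ≤ deviationCube x := by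
  unfold deviationCube; positivity

lemma deviationCube_le_mul {x : ℝ} (hx : 0 ≤ x) : deviationCube x ≤ 3 * x := by
  have h1 := sq_mul_exp_neg_le hx
  have h2 : Real.exp (-x) ≤ 1 := Real.exp_le_one_iff.2 (by linarith)
  rw [deviationCube]
  nlinarith

/-- Berry–Esseen type bound for the characteristic function of an infinite sum of deviations. -/
lemma norm_charFun_sum_deviation_sub_le (hX : ∀ j, HasLaw (X j) (poissonMeasure (x j)) P)
    (hind : iIndepFun X P) (hx : Summable fun j => (x j : ℝ)) {S : Ω → ℝ}
    (hS : ∀ ω, HasSum (fun j => deviation (x j) (X j ω)) (S ω)) (s : ℝ) :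
    ‖charFun (P.map S) s - Real.exp (-(s ^ 2 / 2 * ∑' j, deviationVar (x j)))‖
      ≤ 4 * |s| ^ 3 * ∑' j, deviationCube (x j)
        + s ^ 4 / 4 * (3 * ∑' j, deviationVar (x j)) := by
  have hYm : ∀ j, AEMeasurable (fun ω => deviation (x j) (X j ω)) P := fun j =>
    (Measurable.of_discrete (f := deviation (x j))).comp_aemeasurable (hX j).aemeasurable
  have hYind : iIndepFun (fun j ω => deviation (x j) (X j ω)) P :=
    hind.comp (fun j => deviation (x j)) fun j => Measurable.of_discrete
  have hnm : ∀ n, AEMeasurable (fun ω => ∑ j ∈ Finset.range n, deviation (x j) (X j ω)) P :=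
    fun n => Finset.aemeasurable_fun_sum _ fun j _ => hYm j
  have hSm : AEMeasurable S P :=
    aemeasurable_of_tendsto_metrizable_ae' hnm (ae_of_all _ fun ω => (hS ω).tendsto_sum_nat)
  have hVar : Summable fun j => deviationVar (x j) :=
    .of_nonneg_of_le (fun j => deviationVar_nonneg (x j).2)
      (fun j => deviationVar_le_mul (x j).2) (hx.mul_left 2)
  have hCube : Summable fun j => deviationCube (x j) :=
    .of_nonneg_of_le (fun j => deviationCube_nonneg (x j).2)
      (fun j => deviationCube_le_mul (x j).2) (hx.mul_left 3)
  set φ : ℕ → ℂ := fun j => charFun (P.map fun ω => deviation (x j) (X j ω)) s with hφ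
  have hφ_eq : ∀ j, φ j = 1 + Real.exp (-x j) * (Complex.exp ((-(s * x j) : ℝ) * Complex.I) - 1)
        + x j * Real.exp (-x j) * (Complex.exp (s * Complex.I) - 1) := fun j => by
    rw [← integral_exp_deviation, hφ]
    simp only
    rw [charFun_apply_real, integral_map (hYm j) (by fun_prop)]
    exact (hX j).integral_comp (f := fun n => Complex.exp (s * deviation (x j) n * Complex.I))
      Measurable.of_discrete.aestronglyMeasurable
  have hφ1 : ∀ j, ‖φ j‖ ≤ 1 := fun j => by
    have := Measure.isProbabilityMeasure_map (hYm j)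
    exact norm_charFun_le_one _
  have hb1 : ∀ j, ‖((Real.exp (-(s ^ 2 / 2 * deviationVar (x j))) : ℝ) : ℂ)‖ ≤ 1 := fun j => by
    rw [Complex.norm_real, Real.norm_of_nonneg (Real.exp_pos _).le, Real.exp_le_one_iff]
    have := deviationVar_nonneg (x j).2
    have : 0 ≤ s ^ 2 / 2 * deviationVar (x j) := by positivity
    linarith
  have hbound : ∀ n, ‖charFun (P.map fun ω => ∑ j ∈ Finset.range n, deviation (x j) (X j ω)) s
      - Real.exp (-(s ^ 2 / 2 * ∑ j ∈ Finset.range n, deviationVar (x j)))‖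
      ≤ 4 * |s| ^ 3 * ∑' j, deviationCube (x j)
        + s ^ 4 / 4 * (3 * ∑' j, deviationVar (x j)) := by
    intro n
    have e1 : charFun (P.map fun ω => ∑ j ∈ Finset.range n, deviation (x j) (X j ω)) s
        = ∏ j ∈ Finset.range n, φ j := by
      rw [(hYind.restrict _).charFun_map_fun_finsetSum_eq_prod fun j _ => hYm j]
      simp [hφ]
    have e2 : ((Real.exp (-(s ^ 2 / 2 * ∑ j ∈ Finset.range n, deviationVar (x j))) : ℝ) : ℂ)
        = ∏ j ∈ Finset.range n, ((Real.exp (-(s ^ 2 / 2 * deviationVar (x j))) : ℝ) : ℂ) := by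
      rw [← Complex.ofReal_prod, ← Real.exp_sum, Finset.sum_neg_distrib, Finset.mul_sum]
    rw [e1, e2]
    refine (norm_prod_range_sub_prod_range_le _ _ hφ1 hb1 n).trans ?_
    have h1 : ∀ j, ‖φ j - ((Real.exp (-(s ^ 2 / 2 * deviationVar (x j))) : ℝ) : ℂ)‖
        ≤ 4 * |s| ^ 3 * deviationCube (x j) + s ^ 4 / 4 * (3 * deviationVar (x j)) := fun j => by
      rw [hφ_eq]
      refine (norm_charFun_deviation_sub_le (x j).2 s).trans (add_le_add le_rfl ?_)
      refine mul_le_mul_of_nonneg_left ?_ (by positivity)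
      rw [sq]
      -- One of the two variance factors is bounded by 3, which keeps the summed error linear in the
      -- total variance.
      exact mul_le_mul_of_nonneg_right (deviationVar_le (x j).2) (deviationVar_nonneg (x j).2)
    refine (Finset.sum_le_sum fun j _ => h1 j).trans ?_
    rw [Finset.sum_add_distrib, ← Finset.mul_sum, ← Finset.mul_sum, ← Finset.mul_sum]
    have h2 : ∑ j ∈ Finset.range n, deviationCube (x j) ≤ ∑' j, deviationCube (x j) :=
      hCube.sum_le_tsum (Finset.range n) fun j _ => deviationCube_nonneg (x j).2
    have h3 : ∑ j ∈ Finset.range n, deviationVar (x j) ≤ ∑' j, deviationVar (x j) :=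
      hVar.sum_le_tsum (Finset.range n) fun j _ => deviationVar_nonneg (x j).2
    gcongr
  have hlim1 : Tendsto (fun n => charFun
      (P.map fun ω => ∑ j ∈ Finset.range n, deviation (x j) (X j ω)) s) atTop
      (𝓝 (charFun (P.map S) s)) := by
    simp_rw [charFun_apply_real]
    rw [integral_map hSm (by fun_prop)]
    have : ∀ n, ∫ y, Complex.exp (s * y * Complex.I)
        ∂(P.map fun ω => ∑ j ∈ Finset.range n, deviation (x j) (X j ω))
        = ∫ ω, Complex.exp (s * ((∑ j ∈ Finset.range n, deviation (x j) (X j ω) : ℝ) : ℂ)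
          * Complex.I) ∂P := fun n => integral_map (hnm n) (by fun_prop)
    simp_rw [this]
    refine tendsto_integral_of_dominated_convergence (fun _ => 1) (fun n => ?_) (by simp)
      (fun n => ae_of_all _ fun ω => ?_) (ae_of_all _ fun ω => ?_)
    · exact (Continuous.measurable (f := fun y : ℝ => Complex.exp (s * y * Complex.I))
        (by fun_prop)).comp_aemeasurable (hnm n) |>.aestronglyMeasurable
    · rw [← Complex.ofReal_mul, Complex.norm_exp_ofReal_mul_I]
    · exact ((Continuous.tendsto (f := fun y : ℝ => Complex.exp (s * y * Complex.I))
        (by fun_prop) (S ω))).comp (hS ω).tendsto_sum_nat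
  have hlim2 : Tendsto (fun n => ((Real.exp (-(s ^ 2 / 2 * ∑ j ∈ Finset.range n,
      deviationVar (x j))) : ℝ) : ℂ)) atTop
      (𝓝 ((Real.exp (-(s ^ 2 / 2 * ∑' j, deviationVar (x j))) : ℝ) : ℂ)) :=
    (Continuous.tendsto (f := fun y : ℝ => ((Real.exp (-(s ^ 2 / 2 * y)) : ℝ) : ℂ))
      (by fun_prop) _).comp hVar.hasSum.tendsto_sum_nat
  exact le_of_tendsto (hlim1.sub hlim2).norm (Eventually.of_forall hbound)

/-- The mean square error of `∑ j, x_j 1{X_j = 0}`. -/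
lemma integral_sq_sum_unseen_sub_le (hX : ∀ j, HasLaw (X j) (poissonMeasure (x j)) P)
    (hind : iIndepFun X P) (hx : Summable fun j => (x j : ℝ)) {W : Ω → ℝ}
    (hW : ∀ ω, HasSum (fun j => if X j ω = 0 then (x j : ℝ) else 0) (W ω)) :
    Integrable (fun ω => (W ω - ∑' j, (x j : ℝ) * Real.exp (-x j)) ^ 2) P ∧
    ∫ ω, (W ω - ∑' j, (x j : ℝ) * Real.exp (-x j)) ^ 2 ∂P
      ≤ ∑' j, (x j : ℝ) ^ 2 * Real.exp (-x j) := by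
  set T := ∑' j, (x j : ℝ) with hT
  set Z : ℕ → Ω → ℝ := fun j ω => if X j ω = 0 then (x j : ℝ) else 0 with hZ
  have hZm : ∀ j, AEMeasurable (Z j) P := fun j =>
    (Measurable.of_discrete (f := fun n : ℕ => if n = 0 then (x j : ℝ) else 0)).comp_aemeasurable
      (hX j).aemeasurable
  have hZ0 : ∀ j ω, 0 ≤ Z j ω := fun j ω => by simp only [hZ]; split_ifs <;> simp
  have hZ1 : ∀ j ω, Z j ω ≤ x j := fun j ω => by simp only [hZ]; split_ifs <;> simp
  have hZL : ∀ j, MemLp (Z j) 2 P := fun j =>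
    MemLp.of_bound (hZm j).aestronglyMeasurable (x j) (ae_of_all _ fun ω => by
      rw [Real.norm_of_nonneg (hZ0 j ω)]; exact hZ1 j ω)
  have hZind : iIndepFun Z P :=
    hind.comp (fun j n => if n = 0 then (x j : ℝ) else 0) fun j => Measurable.of_discrete
  have hmean : ∀ j, ∫ ω, Z j ω ∂P = x j * Real.exp (-x j) := fun j => by
    have := integral_ite_eq_of_hasLaw_poisson (hX j) 0 (x j)
    simpa using this
  have hmean2 : ∀ j, ∫ ω, Z j ω ^ 2 ∂P = (x j : ℝ) ^ 2 * Real.exp (-x j) := fun j => by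
    have := integral_ite_eq_of_hasLaw_poisson (hX j) 0 ((x j : ℝ) ^ 2)
    simpa [hZ, ite_pow] using this
  have he1 : ∀ j, Real.exp (-(x j : ℝ)) ≤ 1 := fun j => Real.exp_le_one_iff.2 (by simp)
  have hsum1 : Summable fun j => (x j : ℝ) * Real.exp (-x j) :=
    .of_nonneg_of_le (fun j => by positivity)
      (fun j => mul_le_of_le_one_right (x j).2 (he1 j)) hx
  have hsum2 : Summable fun j => (x j : ℝ) ^ 2 * Real.exp (-x j) := by
    refine .of_nonneg_of_le (fun j => by positivity) (fun j => ?_) hx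
    have := mul_le_mul_of_nonneg_left (self_mul_exp_neg_le (x := x j)) (x j).2
    simp only [NNReal.val_eq_coe] at this
    nlinarith
  set W' : ℕ → Ω → ℝ := fun n => ∑ j ∈ Finset.range n, Z j with hW'
  have hW'm : ∀ n, AEMeasurable (W' n) P := fun n => Finset.aemeasurable_sum _ fun j _ => hZm j
  have hlimW : ∀ ω, Tendsto (fun n => W' n ω) atTop (𝓝 (W ω)) := fun ω => by
    simpa [hW'] using (hW ω).tendsto_sum_nat
  have hWm : AEMeasurable W P := aemeasurable_of_tendsto_metrizable_ae' hW'm (ae_of_all _ hlimW)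
  have hW'0 : ∀ n ω, 0 ≤ W' n ω := fun n ω => by
    simp only [hW', Finset.sum_apply]; exact Finset.sum_nonneg fun j _ => hZ0 j ω
  have hW'1 : ∀ n ω, W' n ω ≤ T := fun n ω => by
    simp only [hW', Finset.sum_apply]
    exact (Finset.sum_le_sum fun j _ => hZ1 j ω).trans (hx.sum_le_tsum _ fun j _ => (x j).2)
  set A : ℕ → ℝ := fun n => ∑ j ∈ Finset.range n, (x j : ℝ) * Real.exp (-x j) with hA
  have hA0 : ∀ n, 0 ≤ A n := fun n => Finset.sum_nonneg fun j _ => by positivity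
  have hA1 : ∀ n, A n ≤ T := fun n =>
    (Finset.sum_le_sum fun j _ => mul_le_of_le_one_right (x j).2 (he1 j)).trans
      (hx.sum_le_tsum _ fun j _ => (x j).2)
  have hlimA := hsum1.hasSum.tendsto_sum_nat
  have hvar : ∀ n, ∫ ω, (W' n ω - A n) ^ 2 ∂P ≤ ∑' j, (x j : ℝ) ^ 2 * Real.exp (-x j) := by
    intro n
    have hm : ∫ ω, W' n ω ∂P = A n := by
      simp only [hW', Finset.sum_apply]
      rw [integral_finsetSum _ fun j _ => (hZL j).integrable (by norm_num)]
      simp [hmean, hA]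
    rw [← hm, ← variance_eq_integral (hW'm n), hW',
      IndepFun.variance_sum (fun j _ => hZL j) fun i _ j _ hij => hZind.indepFun hij]
    refine (Finset.sum_le_sum fun j _ => ?_).trans
      (hsum2.sum_le_tsum (Finset.range n) fun j _ => by positivity)
    rw [← hmean2]
    exact variance_le_expectation_sq (hZm j).aestronglyMeasurable
  -- Partial sums and their means both lie in `[0, T]`; this gives the dominating constant for the
  -- passage to the limit.
  have hsq : ∀ n ω, ‖(W' n ω - A n) ^ 2‖ ≤ T ^ 2 := fun n ω => by
    rw [Real.norm_of_nonneg (sq_nonneg _), sq_le_sq, abs_of_nonneg ((hA0 n).trans (hA1 n)), abs_le]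
    constructor <;> linarith [hW'0 n ω, hW'1 n ω, hA0 n, hA1 n]
  have hlim : ∀ ω, Tendsto (fun n => (W' n ω - A n) ^ 2) atTop
      (𝓝 ((W ω - ∑' j, (x j : ℝ) * Real.exp (-x j)) ^ 2)) := fun ω =>
    ((hlimW ω).sub hlimA).pow 2
  refine ⟨Integrable.of_bound ((hWm.sub_const _).pow_const 2).aestronglyMeasurable (T ^ 2)
    (ae_of_all _ fun ω => le_of_tendsto (hlim ω).norm (Eventually.of_forall fun n => hsq n ω)), ?_⟩
  refine le_of_tendsto (tendsto_integral_of_dominated_convergence (fun _ => T ^ 2)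
    (fun n => (((hW'm n).sub_const _).pow_const 2).aestronglyMeasurable) (by simp)
    (fun n => ae_of_all _ (hsq n)) (ae_of_all _ hlim)) (Eventually.of_forall hvar)

end PoissonSums

end UrnScheme

namespace UrnScheme

/-! ### Asymptotic normality of the Good–Turing estimator -/

section GoodTuring

variable {Ω : Type*} {p : PMF ℕ} {U : ℕ → Ω → ℕ} {N : ℝ≥0 → Ω → ℕ}

lemma finite_setOf_occurrences_ne_zero (U : ℕ → Ω → ℕ) (N : ℝ≥0 → Ω → ℕ) (t : ℝ≥0) (ω : Ω) :
    {j | occurrences U N t j ω ≠ 0}.Finite := by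
  refine ((Finset.range (N t ω)).image fun i => U i ω).finite_toSet.subset fun j hj => ?_
  obtain ⟨i, hi, hij⟩ := Finset.exists_ne_zero_of_sum_ne_zero hj
  simp only [ne_eq, ite_eq_right_iff, one_ne_zero, imp_false, not_not] at hij
  exact Finset.mem_coe.2 (Finset.mem_image.2 ⟨i, hi, hij⟩)

lemma hasSum_occupancyCount (U : ℕ → Ω → ℕ) (N : ℝ≥0 → Ω → ℕ) {r : ℕ} (hr : r ≠ 0) (t : ℝ≥0)
    (ω : Ω) :
    HasSum (fun j => if occurrences U N t j ω = r then (1 : ℝ) else 0)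
      (occupancyCount U N r t ω) := by
  have hfin : {j | occurrences U N t j ω = r}.Finite :=
    (finite_setOf_occurrences_ne_zero U N t ω).subset fun j (hj : _ = r) => by
      simpa [hj] using hr
  have h : HasSum (fun j => if occurrences U N t j ω = r then (1 : ℝ) else 0)
      (∑ j ∈ hfin.toFinset, if occurrences U N t j ω = r then (1 : ℝ) else 0) :=
    hasSum_sum_of_ne_finset_zero fun j hj => by
      have : occurrences U N t j ω ≠ r := fun h => hj (hfin.mem_toFinset.2 h)
      simp [this]
  convert h using 1
  have h1 : ∀ j ∈ hfin.toFinset, (if occurrences U N t j ω = r then (1 : ℝ) else 0) = 1 :=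
    fun j hj => if_pos (by simpa using hj)
  rw [occupancyCount, Set.ncard_eq_toFinset_card _ hfin, Finset.sum_congr rfl h1]
  simp

lemma hasSum_rareMass (p : PMF ℕ) (U : ℕ → Ω → ℕ) (N : ℝ≥0 → Ω → ℕ) (r : ℕ) (t : ℝ≥0) (ω : Ω) :
    HasSum (fun j => if occurrences U N t j ω = r then (p j).toReal else 0)
      (rareMass p U N r t ω) := by
  refine Summable.hasSum (.of_nonneg_of_le (fun j => ?_) (fun j => ?_) (summable_toReal p))
  all_goals split_ifs <;> simp

/-- A finite sample misses some symbol of an infinite support, so divisions by the missing mass are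
genuine. -/
lemma missingMass_pos (hp : p.support.Infinite) (U : ℕ → Ω → ℕ) (N : ℝ≥0 → Ω → ℕ) (t : ℝ≥0)
    (ω : Ω) : 0 < rareMass p U N 0 t ω := by
  obtain ⟨j, hj, hj0⟩ := hp.exists_notMem_finite (finite_setOf_occurrences_ne_zero U N t ω)
  have hj0' : occurrences U N t j ω = 0 := by simpa using hj0
  refine (hasSum_rareMass p U N 0 t ω).summable.tsum_pos (fun i => ?_) j ?_
  · split_ifs <;> simp
  · rw [if_pos hj0']
    exact ENNReal.toReal_pos ((PMF.mem_support_iff _ _).1 hj) (p.apply_ne_top j)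

lemma summable_rate (p : PMF ℕ) (t : ℝ≥0) : Summable fun j => (rate p t j : ℝ) :=
  (summable_toReal p).mul_left _

lemma hasSum_deviation (p : PMF ℕ) (U : ℕ → Ω → ℕ) (N : ℝ≥0 → Ω → ℕ) (t : ℝ≥0) (ω : Ω) :
    HasSum (fun j => deviation (rate p t j) (occurrences U N t j ω))
      (occupancyCount U N 1 t ω - t * rareMass p U N 0 t ω) := by
  refine ((hasSum_occupancyCount U N one_ne_zero t ω).sub
    ((hasSum_rareMass p U N 0 t ω).mul_left (t : ℝ))).congr_fun fun j => ?_
  simp [deviation, coe_rate]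

variable [MeasurableSpace Ω] {P : Measure Ω}

/-- For `r = k + 1`, the bound `x^k / k! ≤ e^x` makes each weight at most the rate itself. -/
lemma summable_poisson_weight (p : PMF ℕ) (t : ℝ≥0) {r : ℕ} (hr : r ≠ 0) :
    Summable fun j => Real.exp (-rate p t j) * (rate p t j : ℝ) ^ r / (r.factorial : ℝ) := by
  obtain ⟨k, rfl⟩ := Nat.exists_eq_succ_of_ne_zero hr
  refine .of_nonneg_of_le (fun j => by positivity) (fun j => ?_) (summable_rate p t)
  have h := Real.pow_div_factorial_le_exp (rate p t j : ℝ) (rate p t j).2 k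
  rw [div_le_iff₀ (by positivity)] at h
  rw [div_le_iff₀ (by positivity), Real.exp_neg, inv_mul_le_iff₀ (Real.exp_pos _),
    Nat.factorial_succ, pow_succ]
  push_cast
  have h0 : (0 : ℝ) ≤ rate p t j := (rate p t j).2
  have h1 : (rate p t j : ℝ) ^ k * rate p t j
      ≤ Real.exp (rate p t j) * k.factorial * rate p t j := mul_le_mul_of_nonneg_right h h0
  have h2 : 0 ≤ Real.exp (rate p t j) * k.factorial * rate p t j * k := by positivity
  nlinarith

lemma IsPoissonSetting.aemeasurable_occupancyCount (hS : IsPoissonSetting P p U N) {r : ℕ}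
    (hr : r ≠ 0) (t : ℝ≥0) : AEMeasurable (occupancyCount U N r t) P := by
  refine aemeasurable_of_tendsto_metrizable_ae' (fun n => ?_)
    (ae_of_all _ fun ω => (hasSum_occupancyCount U N hr t ω).tendsto_sum_nat)
  refine Finset.aemeasurable_fun_sum _ fun j _ => ?_
  exact (Measurable.of_discrete (f := fun n : ℕ => if n = r then (1 : ℝ) else 0)).comp_aemeasurable
    (hS.aemeasurable_occurrences t j)

lemma IsPoissonSetting.aemeasurable_rareMass (hS : IsPoissonSetting P p U N) (r : ℕ) (t : ℝ≥0) :
    AEMeasurable (rareMass p U N r t) P := by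
  refine aemeasurable_of_tendsto_metrizable_ae' (fun n => ?_)
    (ae_of_all _ fun ω => (hasSum_rareMass p U N r t ω).tendsto_sum_nat)
  refine Finset.aemeasurable_fun_sum _ fun j _ => ?_
  exact (Measurable.of_discrete
    (f := fun n : ℕ => if n = r then (p j).toReal else 0)).comp_aemeasurable
    (hS.aemeasurable_occurrences t j)

variable [IsProbabilityMeasure P]

lemma IsPoissonSetting.expectedCount_eq (hS : IsPoissonSetting P p U N) {r : ℕ} (hr : r ≠ 0)
    (t : ℝ≥0) : expectedCount P U N r t
      = ∑' j, Real.exp (-rate p t j) * (rate p t j : ℝ) ^ r / (r.factorial : ℝ) := by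
  have hint : ∀ j, ∫ ω, (if occurrences U N t j ω = r then (1 : ℝ) else 0) ∂P
      = Real.exp (-rate p t j) * (rate p t j : ℝ) ^ r / (r.factorial : ℝ) := fun j => by
    rw [integral_ite_eq_of_hasLaw_poisson (hS.hasLaw_occurrences t j), one_mul]
  have h := integral_tsum_of_summable_integral_norm (μ := P)
    (F := fun j ω => if occurrences U N t j ω = r then (1 : ℝ) else 0)
    (fun j => integrable_comp_of_hasLaw (hS.aemeasurable_occurrences t j)
      (fun n => if n = r then (1 : ℝ) else 0) (C := 1)
      (fun n => by split_ifs <;> simp)) (by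
      refine (summable_poisson_weight p t hr).congr fun j => ?_
      rw [← hint]
      refine integral_congr_ae (ae_of_all _ fun ω => ?_)
      dsimp only
      split_ifs <;> simp)
  simp_rw [hint] at h
  rw [h, expectedCount]
  exact integral_congr_ae (ae_of_all _ fun ω => (hasSum_occupancyCount U N hr t ω).tsum_eq.symm)

lemma IsPoissonSetting.expectedCount_one (hS : IsPoissonSetting P p U N) (t : ℝ≥0) :
    expectedCount P U N 1 t = meanOnes p t := by
  rw [hS.expectedCount_eq one_ne_zero, meanOnes]
  refine tsum_congr fun j => ?_
  rw [coe_rate]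
  simp [mul_comm]

lemma IsPoissonSetting.expectedCount_one_add_two_mul (hS : IsPoissonSetting P p U N) (t : ℝ≥0) :
    expectedCount P U N 1 t + 2 * expectedCount P U N 2 t = ∑' j, deviationVar (rate p t j) := by
  rw [hS.expectedCount_eq one_ne_zero, hS.expectedCount_eq two_ne_zero, ← tsum_mul_left,
    ← (summable_poisson_weight p t one_ne_zero).tsum_add
      ((summable_poisson_weight p t two_ne_zero).mul_left 2)]
  refine tsum_congr fun j => ?_
  simp [deviationVar, Nat.factorial]
  ring

lemma summable_deviationVar_rate (p : PMF ℕ) (t : ℝ≥0) :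
    Summable fun j => deviationVar (rate p t j) :=
  .of_nonneg_of_le (fun j => deviationVar_nonneg (rate p t j).2)
    (fun j => deviationVar_le_mul (rate p t j).2) ((summable_rate p t).mul_left 2)

lemma summable_deviationCube_rate (p : PMF ℕ) (t : ℝ≥0) :
    Summable fun j => deviationCube (rate p t j) :=
  .of_nonneg_of_le (fun j => deviationCube_nonneg (rate p t j).2)
    (fun j => deviationCube_le_mul (rate p t j).2) ((summable_rate p t).mul_left 3)

lemma meanOnes_le_tsum_deviationVar (p : PMF ℕ) (t : ℝ≥0) :
    meanOnes p t ≤ ∑' j, deviationVar (rate p t j) := by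
  refine (summable_meanOnes p t.2).tsum_le_tsum (fun j => ?_) (summable_deviationVar_rate p t)
  rw [deviationVar, coe_rate]
  exact mul_le_mul_of_nonneg_right (le_add_of_nonneg_right (sq_nonneg _)) (Real.exp_pos _).le

/-- The constants come from `x + x³ ≤ 2x` on `[0, 1]` and from `x e^{-x} ≤ 1`, `x³ e^{-x} ≤ 6`
beyond. -/
lemma tsum_deviationCube_le (p : PMF ℕ) {t : ℝ≥0} (ht : 0 < t) :
    ∑' j, deviationCube (rate p t j)
      ≤ 2 * meanOnes p t + 7 * countingFunction p (1 / t) := by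
  refine tsum_le_meanOnes_add_countingFunction p (t := t) (f := deviationCube) ht
    zero_le_two (fun x h0 h1 => ?_) (fun x h1 => ?_) (summable_deviationCube_rate p t)
  · rw [deviationCube, ← mul_assoc]
    refine mul_le_mul_of_nonneg_right ?_ (Real.exp_pos _).le
    have := pow_le_of_le_one h0 h1 (three_ne_zero)
    linarith
  · have h2 := cube_mul_exp_neg_le (zero_le_one.trans h1)
    have h3 := self_mul_exp_neg_le (x := x)
    rw [deviationCube, add_mul]
    linarith

lemma tsum_sq_mul_exp_le (p : PMF ℕ) {t : ℝ≥0} (ht : 0 < t) :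
    ∑' j, (rate p t j : ℝ) ^ 2 * Real.exp (-rate p t j)
      ≤ 1 * meanOnes p t + 2 * countingFunction p (1 / t) := by
  refine tsum_le_meanOnes_add_countingFunction p (t := t) (f := fun x => x ^ 2 * Real.exp (-x)) ht
    zero_le_one (fun x h0 h1 => ?_) (fun x h1 => sq_mul_exp_neg_le (zero_le_one.trans h1)) ?_
  · rw [one_mul]
    exact mul_le_mul_of_nonneg_right (pow_le_of_le_one h0 h1 two_ne_zero) (Real.exp_pos _).le
  · refine .of_nonneg_of_le (fun j => by positivity) (fun j => ?_)
      (summable_deviationVar_rate p t)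
    rw [deviationVar, coe_rate]
    exact mul_le_mul_of_nonneg_right (le_add_of_nonneg_left (by positivity)) (Real.exp_pos _).le

/-- At frequency `s/√V` the Gaussian term is exactly `exp(-s²/2)`. The cubic error is `O(V) ·
V^{-3/2}` and the quartic one `O(V) · V^{-2}`; both vanish as `V → ∞`. -/
lemma IsPoissonSetting.tendsto_charFun_normalized (hS : IsPoissonSetting P p U N) {α : ℝ}
    (hα : 0 < α) (hν : IsRegularlyVarying p α) (s : ℝ) :
    Tendsto (fun t : ℝ≥0 => charFun (P.map fun ω =>
      (√(∑' j, deviationVar (rate p t j)))⁻¹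
        * (occupancyCount U N 1 t ω - t * rareMass p U N 0 t ω)) s) atTop
      (𝓝 (Real.exp (-(s ^ 2 / 2)) : ℝ)) := by
  obtain ⟨C, hC, hev⟩ := hν.exists_countingFunction_le hα
  have hcoe : Tendsto (fun t : ℝ≥0 => (t : ℝ)) atTop atTop := NNReal.tendsto_coe_atTop.2 tendsto_id
  have ha := (hν.tendsto_meanOnes hα).comp hcoe
  set V : ℝ≥0 → ℝ := fun t => ∑' j, deviationVar (rate p t j) with hV
  have hVlim : Tendsto V atTop atTop :=
    tendsto_atTop_mono (fun t => meanOnes_le_tsum_deviationVar p t) ha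
  have hsq : Tendsto (fun t => √(V t)) atTop atTop := Real.tendsto_sqrt_atTop.comp hVlim
  have hlim : Tendsto (fun t => 4 * |s| ^ 3 * (2 + 7 * C) * (√(V t))⁻¹
      + s ^ 4 / 4 * 3 * (V t)⁻¹) atTop (𝓝 0) := by
    have h1 := (tendsto_inv_atTop_zero.comp hsq).const_mul (4 * |s| ^ 3 * (2 + 7 * C))
    have h2 := (tendsto_inv_atTop_zero.comp hVlim).const_mul (s ^ 4 / 4 * 3)
    simpa using h1.add h2
  rw [tendsto_iff_norm_sub_tendsto_zero]
  refine squeeze_zero' (Eventually.of_forall fun t => norm_nonneg _) ?_ hlim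
  filter_upwards [hcoe.eventually hev, hVlim.eventually_gt_atTop 0, eventually_gt_atTop 0]
    with t hct hVt ht
  have hm : AEMeasurable (fun ω => occupancyCount U N 1 t ω - t * rareMass p U N 0 t ω) P :=
    (hS.aemeasurable_occupancyCount one_ne_zero t).sub ((hS.aemeasurable_rareMass 0 t).const_mul _)
  rw [charFun_map_mul_comp hm]
  have key := norm_charFun_sum_deviation_sub_le (fun j => hS.hasLaw_occurrences t j)
    (hS.iIndepFun_occurrences t) (summable_rate p t) (fun ω => hasSum_deviation p U N t ω)
    ((√(V t))⁻¹ * s)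
  have hr : 0 < √(V t) := Real.sqrt_pos.2 hVt
  have hr2 : √(V t) ^ 2 = V t := Real.sq_sqrt hVt.le
  have e1 : ((√(V t))⁻¹ * s) ^ 2 / 2 * V t = s ^ 2 / 2 := by
    rw [mul_pow, inv_pow, hr2]; field_simp
  rw [show (∑' j, deviationVar (rate p t j)) = V t from rfl, e1] at key
  refine key.trans (add_le_add ?_ (le_of_eq ?_))
  · have h1 : ∑' j, deviationCube (rate p t j) ≤ (2 + 7 * C) * V t := by
      have h2 := tsum_deviationCube_le p ht
      have h3 : meanOnes p t ≤ V t := meanOnes_le_tsum_deviationVar p t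
      have h4 : C * meanOnes p t ≤ C * V t := mul_le_mul_of_nonneg_left h3 hC.le
      linarith
    calc 4 * |(√(V t))⁻¹ * s| ^ 3 * ∑' j, deviationCube (rate p t j)
        ≤ 4 * |(√(V t))⁻¹ * s| ^ 3 * ((2 + 7 * C) * V t) := by gcongr
      _ = 4 * |s| ^ 3 * (2 + 7 * C) * (√(V t))⁻¹ := by
        rw [abs_mul, abs_of_pos (inv_pos.2 hr), ← hr2, Real.sqrt_sq hr.le]
        field_simp
  · have h4 : (√(V t))⁻¹ ^ 4 = (V t)⁻¹ ^ 2 := by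
      rw [show (4 : ℕ) = 2 * 2 from rfl, pow_mul, inv_pow, hr2]
    rw [mul_pow, h4]
    field_simp

lemma IsPoissonSetting.tendstoInDistribution_normalized (hS : IsPoissonSetting P p U N) {α : ℝ}
    (hα : 0 < α) (hν : IsRegularlyVarying p α) :
    TendstoInDistribution (fun (t : ℝ≥0) ω => (√(∑' j, deviationVar (rate p t j)))⁻¹
        * (occupancyCount U N 1 t ω - t * rareMass p U N 0 t ω)) atTop (id : ℝ → ℝ)
      (fun _ => P) (gaussianReal 0 1) where
  forall_aemeasurable t := ((hS.aemeasurable_occupancyCount one_ne_zero t).sub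
    ((hS.aemeasurable_rareMass 0 t).const_mul _)).const_mul _
  aemeasurable_limit := aemeasurable_id
  tendsto := by
    -- Since `atTop` on `ℝ≥0` is countably generated, sequences suffice, and Lévy's continuity
    -- theorem applies along each.
    refine tendsto_of_seq_tendsto fun u hu => ?_
    refine ProbabilityMeasure.tendsto_of_tendsto_charFun fun s => ?_
    have := (hS.tendsto_charFun_normalized hα hν s).comp hu
    simp only [ProbabilityMeasure.coe_mk, Measure.map_id, charFun_gaussianReal]
    convert this using 2
    congr 1
    simp

/-- Chebyshev's argument: `t M_0` has mean `a = E K_1 → ∞` and variance `O(a)`. -/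
lemma IsPoissonSetting.tendstoInMeasure_missingMass (hS : IsPoissonSetting P p U N) {α : ℝ}
    (hα : 0 < α) (hν : IsRegularlyVarying p α) :
    TendstoInMeasure P (fun (t : ℝ≥0) ω => meanOnes p t / (t * rareMass p U N 0 t ω)) atTop
      (fun _ => 1) := by
  obtain ⟨C, hC, hev⟩ := hν.exists_countingFunction_le hα
  have hcoe : Tendsto (fun t : ℝ≥0 => (t : ℝ)) atTop atTop := NNReal.tendsto_coe_atTop.2 tendsto_id
  have ha := (hν.tendsto_meanOnes hα).comp hcoe
  rw [tendstoInMeasure_iff_measureReal_dist]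
  intro ε hε
  -- If `|a/W - 1| ≥ ε`, then `|W - a| ≥ εW ≥ ε(a - |W - a|)`, that is, `|W - a| ≥ δa`.
  set δ := ε / (1 + ε) with hδ
  have hδ0 : 0 < δ := by positivity
  have hlim : Tendsto (fun t : ℝ≥0 => (1 + 2 * C) / δ ^ 2 * (meanOnes p t)⁻¹) atTop (𝓝 0) := by
    simpa using (tendsto_inv_atTop_zero.comp ha).const_mul ((1 + 2 * C) / δ ^ 2)
  refine squeeze_zero' (Eventually.of_forall fun t => measureReal_nonneg) ?_ hlim
  filter_upwards [hcoe.eventually hev, ha.eventually_gt_atTop 0, eventually_gt_atTop 0]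
    with t hct hat ht
  simp only [Function.comp_apply] at hat
  have htr : (0 : ℝ) < t := ht
  set a := meanOnes p t with ha_def
  set W : Ω → ℝ := fun ω => t * rareMass p U N 0 t ω with hW
  have hmean : ∑' j, (rate p t j : ℝ) * Real.exp (-rate p t j) = a := rfl
  obtain ⟨hint, hle⟩ := integral_sq_sum_unseen_sub_le (fun j => hS.hasLaw_occurrences t j)
    (hS.iIndepFun_occurrences t) (summable_rate p t) (W := W) fun ω =>
      ((hasSum_rareMass p U N 0 t ω).mul_left (t : ℝ)).congr_fun fun j => by simp [coe_rate]
  rw [hmean] at hint hle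
  have hmarkov := mul_meas_ge_le_integral_of_nonneg
    (ae_of_all _ fun ω => sq_nonneg (W ω - a)) hint ((δ * a) ^ 2)
  have hb : ∫ ω, (W ω - a) ^ 2 ∂P ≤ (1 + 2 * C) * a := by
    have := tsum_sq_mul_exp_le p ht
    linarith
  have hsub : {ω | ε ≤ dist (a / W ω) 1} ⊆ {ω | (δ * a) ^ 2 ≤ (W ω - a) ^ 2} := by
    intro ω hω
    have hWpos : 0 < W ω := mul_pos htr (missingMass_pos (hν.infinite_support hα) U N t ω)
    simp only [Set.mem_ofPred_eq, Real.dist_eq] at hω ⊢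
    rw [sq_le_sq, abs_of_pos (mul_pos hδ0 hat)]
    have e : a / W ω - 1 = (a - W ω) / W ω := by field_simp
    rw [e, abs_div, abs_of_pos hWpos, le_div_iff₀ hWpos, abs_sub_comm] at hω
    rw [hδ, div_mul_eq_mul_div, div_le_iff₀ (by positivity)]
    have : a ≤ W ω + |W ω - a| := by linarith [neg_abs_le (W ω - a)]
    nlinarith
  have hP : P.real {ω | ε ≤ dist (a / W ω) 1} ≤ P.real {ω | (δ * a) ^ 2 ≤ (W ω - a) ^ 2} :=
    measureReal_mono hsub
  refine hP.trans ?_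
  have hda : 0 < (δ * a) ^ 2 := by positivity
  have h5 := hmarkov.trans hb
  rw [mul_comm, ← le_div_iff₀ hda] at h5
  refine h5.trans (le_of_eq ?_)
  field_simp

end GoodTuring

end UrnScheme

theorem mainTheorem11 {Ω : Type*} [MeasurableSpace Ω] (P : Measure Ω) [IsProbabilityMeasure P]
    (p : PMF ℕ) (U : ℕ → Ω → ℕ) (N : ℝ≥0 → Ω → ℕ)
    (hS : UrnScheme.IsPoissonSetting P p U N)
    (α : ℝ) (hα0 : 0 < α) (hα1 : α ≤ 1) (hν : UrnScheme.IsRegularlyVarying p α) :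
    TendstoInDistribution
      (fun (t : ℝ≥0) (ω : Ω) =>
        UrnScheme.expectedCount P U N 1 t /
            √(UrnScheme.expectedCount P U N 1 t + 2 * UrnScheme.expectedCount P U N 2 t) *
          (UrnScheme.goodTuring U N 0 t ω / UrnScheme.rareMass p U N 0 t ω - 1))
      atTop (id : ℝ → ℝ) (fun _ => P) (gaussianReal 0 1) := by
  have hlim := (hS.tendstoInDistribution_normalized hα0
    hν).continuous_comp_prodMk_of_tendstoInMeasure_const (g := fun x : ℝ × ℝ => x.1 * x.2)
    (by fun_prop) (hS.tendstoInMeasure_missingMass hα0 hν)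
    (fun t => ((hS.aemeasurable_rareMass 0 t).const_mul _).const_div _)
  simp only [mul_one] at hlim
  refine hlim.congr (fun t => ae_of_all _ fun ω => ?_) (ae_of_all _ fun x => rfl)
  dsimp only
  rw [hS.expectedCount_one_add_two_mul, hS.expectedCount_one, UrnScheme.goodTuring]
  have hM := UrnScheme.missingMass_pos (hν.infinite_support hα0) U N t ω
  -- The identity is needed for every `t`; at `t = 0` both sides are 0 because `meanOnes` vanishes
  -- there.
  rcases eq_or_ne (t : ℝ) 0 with h0 | h0
  · simp [h0, UrnScheme.meanOnes]
  · simp only [Nat.cast_zero, zero_add, one_mul]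
    field_simp
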